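/- Let $G$ be a biautomatic group, let $X\subseteq G$ be a finite subset, and suppose that its centralizer $H=\mathrm{C}_G(X)$ is abelian. Let $\mathrm{Comm}_G(H)=\{g\in G : |H:H\cap gHg^{-1}|<\infty \text{ and } |gHg^{-1}:H\cap gHg^{-1}|<\infty\}$ be the commensurator of $H$ in $G$. Then there is a normal subgroup $\mathrm{Comm}^0_G(H)\lhd \mathrm{Comm}_G(H)$ of finite index in $\mathrm{Comm}_G(H)$ such that for every finitely generated subgroup $F\leqslant \mathrm{Comm}^0_G(H)$ there is a finite-index subgroup $K$ of $H$ that is centralized by $F$, that is, $fk=kf$ for all $f\in F$ and $k\in K$. Here $G$ is called biautomatic if there are a finite set $\mathcal A$ with an involution $a\mapsto a^{-1}$, a map $\mu:\mathcal A\to G$ with $\mu(a^{-1})=\mu(a)^{-1}$ for all $a\in\mathcal A$ whose image generates $G$, and a language $\mathcal L\subseteq \mathcal A^*$ such that: (i) every element of $G$ is represented by a word of $\mathcal L$; (ii) $\mathcal L$ is regular, that is, accepted by a finite state automaton; (iii) there is a constant $\zeta\ge 0$ such that any two edge paths $p,q$ in the Cayley graph of $G$ with respect to $\mathcal A$ that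 are labelled by words of $\mathcal L$ and whose starting points are at distance at most $1$ and whose endpoints are at distance at most $1$ satisfy $\mathrm{d}_{\mathcal A}(\widehat p(t),\widehat q(t))\le\zeta$ for all integers $t\ge 0$. Here $\mathrm{d}_{\mathcal A}$ is the word metric, and $\widehat p(t)$ is the $t$-th vertex of $p$ if $t$ is at most the length of $p$, and the endpoint of $p$ otherwise. -/

import Mathlib

/-- The element of `G` represented by a word over the alphabet `A`, where each letter is sent to an
element of `G` by `μ`. This is the extension of `μ` to the free monoid on `A`. -/
def wordEval {A G : Type*} [Group G] (μ : A → G) (W : List A) : G :=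
  (W.map μ).prod

/-- The word metric on `G`: the length of a shortest word representing `g⁻¹ * h`, that is, the
distance between the vertices `g` and `h` in the Cayley graph. (It is only used when every element
of `G` is represented by some word.) -/
noncomputable def wordDist {A G : Type*} [Group G] (μ : A → G) (g h : G) : ℕ :=
  sInf {n : ℕ | ∃ W : List A, W.length = n ∧ wordEval μ W = g⁻¹ * h}

/-- The vertex reached at time `t` along the edge path of the Cayley graph that starts at `g` and is
labelled by `W`. After time `W.length` the path stays at its endpoint. -/
def pathVertex {A G : Type*} [Group G] (μ : A → G) (g : G) (W : List A) (t : ℕ) : G :=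
  g * wordEval μ (W.take t)

/-- The edge paths starting at `g`, `h` and labelled by `U`, `V` are at distance at most `ζ` from
each other at every integer time. -/
def FellowTravel {A G : Type*} [Group G] (μ : A → G) (ζ : ℕ) (g : G) (U : List A)
    (h : G) (V : List A) : Prop :=
  ∀ t : ℕ, wordDist μ (pathVertex μ g U t) (pathVertex μ h V t) ≤ ζ

/-- `(A, L)`, with the map `μ : A → G`, is a biautomatic structure on the group `G`. -/
structure IsBiautomaticStructure {A G : Type*} [Group G] (μ : A → G) (L : Language A) : Prop where
  /-- The alphabet is finite. -/
  finite_alphabet : Finite A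
  /-- The alphabet is closed under inversion. -/
  closed_inv : ∃ ι : A → A, Function.Involutive ι ∧ ∀ a, μ (ι a) = (μ a)⁻¹
  /-- The alphabet generates the group. -/
  generates : Function.Surjective (wordEval μ)
  /-- Every element of the group is represented by a word of the language. -/
  represents : ∀ g : G, ∃ W ∈ L, wordEval μ W = g
  /-- The language is accepted by a finite state automaton. -/
  regular : L.IsRegular
  /-- Paths labelled by words of the language that start and end at distance at most one from each
  other uniformly fellow travel. -/
  fellow_travel : ∃ ζ : ℕ, ∀ U ∈ L, ∀ V ∈ L, ∀ g h : G,
    wordDist μ g h ≤ 1 → wordDist μ (g * wordEval μ U) (h * wordEval μ V) ≤ 1 →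
      FellowTravel μ ζ g U h V

/-- A group is biautomatic if it admits a biautomatic structure. -/
def IsBiautomatic (G : Type*) [Group G] : Prop :=
  ∃ (A : Type) (μ : A → G) (L : Language A), IsBiautomaticStructure μ L

/-!
A real character of `H = C_G(X)` is a homomorphism `f : H → ℝ`. Call it length bounded if
`f h ≤ |W| + M` for some constant `M` and all words `W ∈ L` representing an element `h` of `H`.
Multiplying an element on both sides by fixed elements changes the length of a suitable word of `L`
by a bounded amount, and `H ∩ gHg⁻¹` has finitely many cosets in `H`, so the set of length bounded
characters is invariant under the commensurator of `H`.

Let `W ∈ L` represent an element of `H`. Its path fellow travels with its translates by the elements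
of `X`, so the conjugates of these elements by the prefixes of `W` lie in a finite set. Applying the
pigeonhole principle to these conjugates along with the states of the automaton, a long `W` can be
pumped inside `H`, and only finitely many pairs `(c, ℓ)` of a pumped element and the length of the
corresponding factor occur. Hence `H` is finitely generated and the set of length bounded characters
is the polyhedron `{f | f c ≤ ℓ}`. Here `ℓ > 0`, and a character that is nonpositive on all `c` is
bounded above, hence zero.

The commensurator therefore permutes the extreme points of this polyhedron, which are finite in
number and span the space of characters, so a subgroup of finite index fixes all characters of `H`.
As `H` is a finitely generated abelian group, an element `g` of this subgroup satisfies
`g⁻¹ hᵐ g = hᵐ` for every `h ∈ H` and some `m > 0` depending on `h`, and so it centralizes a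
subgroup of finite index of `H`.
-/

section Polyhedra

variable {𝕜 E ι : Type*} [Field 𝕜] [LinearOrder 𝕜] [IsStrictOrderedRing 𝕜] [AddCommGroup E]
  [Module 𝕜 E] {φ : ι → E →ₗ[𝕜] 𝕜} {b : ι → 𝕜}

/-- The polyhedron cut out by the linear inequalities `φ i x ≤ b i`. If it is nonempty, its
recession cone consists of the `v` with `φ i v ≤ 0` for all `i`; triviality of this cone takes the
place of boundedness. -/
def polyhedron (φ : ι → E →ₗ[𝕜] 𝕜) (b : ι → 𝕜) : Set E :=
  {x | ∀ i, φ i x ≤ b i}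

/-- The indices of the defining inequalities of a polyhedron that are equalities at `x`. -/
def tightConstraints (φ : ι → E →ₗ[𝕜] 𝕜) (b : ι → 𝕜) (x : E) : Set ι :=
  {i | φ i x = b i}

theorem mem_openSegment_add_smul_add_smul_neg (x v : E) {s t : 𝕜} (hs : 0 < s) (ht : 0 < t) :
    x ∈ openSegment 𝕜 (x + t • v) (x + s • -v) := by
  refine ⟨s / (s + t), t / (s + t), by positivity, by positivity, by field_simp, ?_⟩
  match_scalars <;> field_simp
  ring

theorem exists_pos_add_smul_mem_polyhedron [Finite ι] {x v : E} (hx : x ∈ polyhedron φ b)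
    (htight : ∀ i ∈ tightConstraints φ b x, φ i v = 0) :
    ∃ t : 𝕜, 0 < t ∧ x + t • v ∈ polyhedron φ b := by
  obtain ⟨M, hM⟩ := Finite.exists_le fun i => φ i v / (b i - φ i x)
  refine ⟨(|M| + 1)⁻¹, by positivity, fun i => ?_⟩
  rw [map_add, map_smul, smul_eq_mul, ← le_sub_iff_add_le', inv_mul_le_iff₀ (by positivity)]
  obtain heq | hlt := (hx i).eq_or_lt
  · rw [htight i heq, heq, sub_self, mul_zero]
  · rw [← div_le_iff₀ (sub_pos.2 hlt)]
    linarith [hM i, le_abs_self M]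

theorem exists_add_smul_tightConstraints_ssubset [Finite ι]
    (hrec : ∀ v, (∀ i, φ i v ≤ 0) → v = 0) {x v : E} (hx : x ∈ polyhedron φ b) (hv : v ≠ 0)
    (htight : ∀ i ∈ tightConstraints φ b x, φ i v = 0) :
    ∃ t : 𝕜, 0 < t ∧ x + t • v ∈ polyhedron φ b ∧
      tightConstraints φ b x ⊂ tightConstraints φ b (x + t • v) := by
  obtain ⟨i₀, hi₀⟩ : ∃ i, 0 < φ i v := by
    by_contra! h
    exact hv (hrec v h)
  -- The ray from `x` in direction `v` leaves the polyhedron where the first inequality turns tight.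
  obtain ⟨j, hj : 0 < φ j v, hmin⟩ := Set.exists_min_image {i | 0 < φ i v}
    (fun i => (b i - φ i x) / φ i v) (Set.toFinite _) ⟨i₀, hi₀⟩
  set t := (b j - φ j x) / φ j v with ht
  have hjx : φ j x < b j := lt_of_le_of_ne (hx j) fun h => hj.ne' (htight j h)
  have htpos : 0 < t := div_pos (sub_pos.2 hjx) hj
  have hval : ∀ i, φ i (x + t • v) = φ i x + t * φ i v := by simp
  refine ⟨t, htpos, fun i => ?_, fun i hi => ?_, fun h => hjx.ne (h ?_)⟩
  · rw [hval]
    rcases le_or_gt (φ i v) 0 with hi | hi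
    · linarith [hx i, mul_nonpos_of_nonneg_of_nonpos htpos.le hi]
    · linarith [(le_div_iff₀ hi).1 (hmin i hi)]
  · exact (hval i).trans (by rw [htight i hi, mul_zero, add_zero]; exact hi)
  · exact (hval j).trans (by rw [ht, div_mul_cancel₀ _ hj.ne', add_sub_cancel])

theorem mem_extremePoints_polyhedron_iff [Finite ι] {x : E} :
    x ∈ (polyhedron φ b).extremePoints 𝕜 ↔
      x ∈ polyhedron φ b ∧ ∀ v, (∀ i ∈ tightConstraints φ b x, φ i v = 0) → v = 0 := by
  rw [mem_extremePoints_iff_left]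
  refine and_congr_right fun hx => ⟨fun hext v hv => ?_, fun htight y hy z hz hxyz => ?_⟩
  · obtain ⟨t, ht, hy⟩ := exists_pos_add_smul_mem_polyhedron hx hv
    obtain ⟨s, hs, hz⟩ := exists_pos_add_smul_mem_polyhedron (v := -v) hx (by simpa using hv)
    have hxt := hext _ hy _ hz (mem_openSegment_add_smul_add_smul_neg x v hs ht)
    exact (smul_eq_zero.1 (add_eq_left.1 hxt)).resolve_left ht.ne'
  · obtain ⟨r, s, hr, hs, hrs, rfl⟩ := hxyz
    refine sub_eq_zero.1 (htight _ fun i hi => ?_)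
    have hxi : r * φ i y + s * φ i z = b i := by
      simpa [tightConstraints] using hi
    have hyi : φ i y = b i := by
      refine le_antisymm (hy i) (le_of_mul_le_mul_left ?_ hr)
      calc r * b i = b i - s * b i := by linear_combination b i * hrs
        _ ≤ r * φ i y := by linarith [mul_le_mul_of_nonneg_left (hz i) hs.le]
    rw [map_sub, hyi, show φ i (r • y + s • z) = b i from hi, sub_self]

theorem finite_extremePoints_polyhedron [Finite ι] :
    ((polyhedron φ b).extremePoints 𝕜).Finite := by
  refine Set.Finite.of_finite_image (f := tightConstraints φ b) (Set.toFinite _)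
    fun x hx y _ hxy => sub_eq_zero.1 ?_
  refine (mem_extremePoints_polyhedron_iff.1 hx).2 _ fun i hi => ?_
  have hyi : φ i y = b i := show i ∈ tightConstraints φ b y from hxy ▸ hi
  rw [map_sub, show φ i x = b i from hi, hyi, sub_self]

theorem polyhedron_subset_convexHull_extremePoints [Finite ι]
    (hrec : ∀ v, (∀ i, φ i v ≤ 0) → v = 0) :
    polyhedron φ b ⊆ convexHull 𝕜 ((polyhedron φ b).extremePoints 𝕜) := by
  intro x hx
  induction hT : tightConstraints φ b x using WellFoundedGT.induction generalizing x with
  | _ T ih =>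
  subst hT
  by_cases hext : x ∈ (polyhedron φ b).extremePoints 𝕜
  · exact subset_convexHull _ _ hext
  · obtain ⟨v, hv, hv0⟩ :
        ∃ v, (∀ i ∈ tightConstraints φ b x, φ i v = 0) ∧ v ≠ 0 := by
      simpa [mem_extremePoints_polyhedron_iff, hx] using hext
    obtain ⟨t, ht, hy, hxy⟩ := exists_add_smul_tightConstraints_ssubset hrec hx hv0 hv
    obtain ⟨s, hs, hz, hxz⟩ := exists_add_smul_tightConstraints_ssubset (v := -v) hrec hx
      (neg_ne_zero.2 hv0) (by simpa using hv)
    exact (convex_convexHull 𝕜 _).openSegment_subset (ih _ hxy hy rfl) (ih _ hxz hz rfl)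
      (mem_openSegment_add_smul_add_smul_neg x v hs ht)

end Polyhedra

section LinearActions

theorem finiteIndex_fixingSubgroup {Γ α : Type*} [Group Γ] [MulAction Γ α] {S : Set α}
    (hS : S.Finite) (hmaps : ∀ g : Γ, Set.MapsTo (g • ·) S S) :
    (fixingSubgroup Γ S).FiniteIndex := by
  have := hS.to_subtype
  let S' : SubMulAction Γ α := ⟨S, fun g _ hx => hmaps g hx⟩
  have : Finite S' := hS
  refine Subgroup.finiteIndex_of_le (H := (MulAction.toPermHom Γ S').ker) fun g hg => ?_
  refine (mem_fixingSubgroup_iff Γ).2 fun x hx => ?_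
  exact congrArg Subtype.val (Equiv.Perm.congr_fun hg (⟨x, hx⟩ : S'))

theorem mapsTo_extremePoints {𝕜 E Γ : Type*} [Field 𝕜] [LinearOrder 𝕜] [IsStrictOrderedRing 𝕜]
    [AddCommGroup E] [Module 𝕜 E] [Group Γ] {ρ : Representation 𝕜 Γ E} {D : Set E}
    (hD : ∀ g, Set.MapsTo (ρ g) D D) (g : Γ) :
    Set.MapsTo (ρ g) (D.extremePoints 𝕜) (D.extremePoints 𝕜) := by
  let e : E ≃ₗ[𝕜] E := LinearEquiv.ofLinearMap (ρ g) (ρ g⁻¹)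
    (LinearMap.ext (ρ.self_inv_apply g)) (LinearMap.ext (ρ.inv_self_apply g))
  have himage : e '' D = D :=
    (hD g).image_subset.antisymm fun x hx => ⟨ρ g⁻¹ x, hD g⁻¹ hx, ρ.self_inv_apply g x⟩
  rw [Set.mapsTo_iff_image_subset]
  exact (image_extremePoints e D).trans_subset (by rw [himage])

theorem finiteIndex_ker_of_mapsTo_polyhedron {𝕜 E ι Γ : Type*} [Field 𝕜] [LinearOrder 𝕜]
    [IsStrictOrderedRing 𝕜] [AddCommGroup E] [Module 𝕜 E] [Finite ι] [Group Γ]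
    {φ : ι → E →ₗ[𝕜] 𝕜} {b : ι → 𝕜} (hrec : ∀ v, (∀ i, φ i v ≤ 0) → v = 0) (hb : ∀ i, 0 < b i)
    (ρ : Representation 𝕜 Γ E) (hmaps : ∀ g, Set.MapsTo (ρ g) (polyhedron φ b) (polyhedron φ b)) :
    ρ.ker.FiniteIndex := by
  let _ : MulAction Γ E := MulAction.compHom E ρ
  have := finiteIndex_fixingSubgroup finite_extremePoints_polyhedron
    (mapsTo_extremePoints hmaps)
  refine Subgroup.finiteIndex_of_le (H := fixingSubgroup Γ ((polyhedron φ b).extremePoints 𝕜))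
    fun g hg => LinearMap.ext fun x => ?_
  have hfix : Set.EqOn (ρ g) LinearMap.id (polyhedron φ b) := fun y hy =>
    convexHull_min (t := LinearMap.eqLocus (ρ g) LinearMap.id)
      (fun e he => (mem_fixingSubgroup_iff Γ).1 hg e he) (Submodule.convex _)
      (polyhedron_subset_convexHull_extremePoints hrec hy)
  have hzero : (0 : E) ∈ polyhedron φ b := fun i => by simpa using (hb i).le
  obtain ⟨ε, hε, hεx⟩ := exists_pos_add_smul_mem_polyhedron (v := x) hzero fun i hi =>
    absurd ((map_zero (φ i)).symm.trans hi) (hb i).ne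
  exact smul_right_injective E hε.ne' (by simpa using hfix hεx)

end LinearActions

section Words

open scoped Pointwise

variable {A G : Type*} [Group G] {μ : A → G} {L : Language A}

theorem wordEval_append (μ : A → G) (U V : List A) :
    wordEval μ (U ++ V) = wordEval μ U * wordEval μ V := by
  simp [wordEval]

theorem wordEval_flatten_replicate (μ : A → G) (W : List A) (n : ℕ) :
    wordEval μ (List.replicate n W).flatten = wordEval μ W ^ n := by
  simp [wordEval, List.map_flatten, List.prod_flatten]

theorem wordEval_append_flatten_replicate_append (μ : A → G) (x y z : List A) (n : ℕ) :
    wordEval μ (x ++ (List.replicate n y).flatten ++ z) =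
      (wordEval μ x * wordEval μ y * (wordEval μ x)⁻¹) ^ n * wordEval μ (x ++ z) := by
  simp only [wordEval_append, wordEval_flatten_replicate, conj_pow]
  group

/-- The ball of radius `n` around the identity in the word metric. -/
def wordBall (μ : A → G) (n : ℕ) : Set G :=
  wordEval μ '' {W | W.length ≤ n}

theorem finite_wordBall [Finite A] (μ : A → G) (n : ℕ) : (wordBall μ n).Finite :=
  (List.finite_length_le A n).image _

theorem wordDist_le_iff (hμ : Function.Surjective (wordEval μ)) {g h : G} {n : ℕ} :
    wordDist μ g h ≤ n ↔ g⁻¹ * h ∈ wordBall μ n := by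
  constructor
  · intro hle
    obtain ⟨W₀, hW₀⟩ := hμ (g⁻¹ * h)
    obtain ⟨W, hlen, hW⟩ :
        wordDist μ g h ∈ {n | ∃ W : List A, W.length = n ∧ wordEval μ W = g⁻¹ * h} :=
      Nat.sInf_mem ⟨_, W₀, rfl, hW₀⟩
    exact ⟨W, hlen.trans_le hle, hW⟩
  · rintro ⟨W, hlen, hW⟩
    exact (Nat.sInf_le (Exists.intro W ⟨rfl, hW⟩)).trans hlen

/-- Any two paths of the Cayley graph that are labelled by words of `L` and whose starting points
and endpoints differ by `p` and by `q` stay close to each other. Closeness is expressed by a finite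
set containing all the differences between them, which makes the notion compatible with
multiplication of the pairs `(p, q)`. -/
def UniformlyFellowTravels (μ : A → G) (L : Language A) (p q : G) : Prop :=
  ∃ S : Set G, S.Finite ∧ ∀ U ∈ L, ∀ V ∈ L, wordEval μ V = p⁻¹ * wordEval μ U * q →
    ∀ t, (wordEval μ (U.take t))⁻¹ * p * wordEval μ (V.take t) ∈ S

theorem UniformlyFellowTravels.mul (hL : ∀ g, ∃ W ∈ L, wordEval μ W = g) {p q p' q' : G}
    (h : UniformlyFellowTravels μ L p q) (h' : UniformlyFellowTravels μ L p' q') :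
    UniformlyFellowTravels μ L (p * p') (q * q') := by
  obtain ⟨S, hS, hmem⟩ := h
  obtain ⟨S', hS', hmem'⟩ := h'
  refine ⟨S * S', hS.mul hS', fun U hU V hV hUV t => ?_⟩
  obtain ⟨W, hW, hUW⟩ := hL (p⁻¹ * wordEval μ U * q)
  have hWV : wordEval μ V = p'⁻¹ * wordEval μ W * q' := by rw [hUV, hUW]; group
  exact ⟨_, hmem U hU W hW hUW t, _, hmem' W hW V hV hWV t, by group⟩

namespace IsBiautomaticStructure

theorem uniformlyFellowTravels_of_mem_wordBall (hL : IsBiautomaticStructure μ L) {p q : G}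
    (hp : p ∈ wordBall μ 1) (hq : q ∈ wordBall μ 1) : UniformlyFellowTravels μ L p q := by
  have := hL.finite_alphabet
  obtain ⟨ζ, hζ⟩ := hL.fellow_travel
  refine ⟨wordBall μ ζ, finite_wordBall μ ζ, fun U hU V hV hUV t => ?_⟩
  have hstart : wordDist μ 1 p ≤ 1 := by simpa [wordDist_le_iff hL.generates] using hp
  have hend : wordDist μ (1 * wordEval μ U) (p * wordEval μ V) ≤ 1 := by
    simpa [wordDist_le_iff hL.generates, hUV, mul_assoc] using hq
  have hclose := (wordDist_le_iff hL.generates).1 (hζ U hU V hV 1 p hstart hend t)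
  simpa [pathVertex, mul_assoc] using hclose

theorem uniformlyFellowTravels (hL : IsBiautomaticStructure μ L) (p q : G) :
    UniformlyFellowTravels μ L p q := by
  have hone : 1 ∈ wordBall μ 1 := ⟨[], by simp, by simp [wordEval]⟩
  have hletter : ∀ a, μ a ∈ wordBall μ 1 := fun a => ⟨[a], by simp, by simp [wordEval]⟩
  have hleft : ∀ P : List A, UniformlyFellowTravels μ L (wordEval μ P) 1 := by
    intro P
    induction P with
    | nil => exact hL.uniformlyFellowTravels_of_mem_wordBall hone hone
    | cons a P ih =>
      simpa [wordEval] using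
        (hL.uniformlyFellowTravels_of_mem_wordBall (hletter a) hone).mul hL.represents ih
  have hright : ∀ Q : List A, UniformlyFellowTravels μ L 1 (wordEval μ Q) := by
    intro Q
    induction Q with
    | nil => exact hL.uniformlyFellowTravels_of_mem_wordBall hone hone
    | cons a Q ih =>
      simpa [wordEval] using
        (hL.uniformlyFellowTravels_of_mem_wordBall hone (hletter a)).mul hL.represents ih
  obtain ⟨P, rfl⟩ := hL.generates p
  obtain ⟨Q, rfl⟩ := hL.generates q
  simpa using (hleft P).mul hL.represents (hright Q)

end IsBiautomaticStructure

end Words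

section Pumping

variable {A : Type*}

theorem exists_lt_map_eq_of_forall_mem_finite {T : Type*} {S : Set T} (hS : S.Finite) {f : ℕ → T}
    (hf : ∀ n, f n ∈ S) (s : ℕ) : ∃ i j, s ≤ i ∧ i < j ∧ j ≤ s + S.ncard ∧ f i = f j := by
  obtain ⟨i, hi, j, hj, hne, hij⟩ := Set.exists_ne_map_eq_of_ncard_lt_of_maps_to
    (s := Set.Icc s (s + S.ncard)) (t := S) (f := f)
    (by rw [← Finset.coe_Icc, Set.ncard_coe_finset, Nat.card_Icc]; omega) (fun n _ => hf n) hS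
  rcases hne.lt_or_gt with hlt | hlt
  · exact ⟨i, j, hi.1, hlt, hj.2, hij⟩
  · exact ⟨j, i, hj.1, hlt, hi.2, hij.symm⟩

theorem append_flatten_replicate_append_mem_accepts {σ : Type*} {M : DFA A σ} {x y z : List A}
    (hmem : x ++ y ++ z ∈ M.accepts) (heval : M.eval x = M.eval (x ++ y)) (n : ℕ) :
    x ++ (List.replicate n y).flatten ++ z ∈ M.accepts := by
  have hloop : M.evalFrom (M.eval x) y = M.eval x := by
    rw [DFA.eval, ← DFA.evalFrom_of_append]
    exact heval.symm
  have hpow : M.evalFrom (M.eval x) (List.replicate n y).flatten = M.eval x :=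
    M.evalFrom_of_pow hloop (Language.join_mem_kstar fun w hw => List.eq_of_mem_replicate hw)
  rw [DFA.mem_accepts, DFA.eval, DFA.evalFrom_of_append, DFA.evalFrom_of_append, ← DFA.eval]
    at hmem ⊢
  rwa [hpow, ← hloop]

theorem exists_pumping_of_isRegular {L : Language A} (hL : L.IsRegular) {T : Type*} {S : Set T}
    (hS : S.Finite) : ∃ N : ℕ, ∀ W ∈ L, ∀ s, s + N ≤ W.length → ∀ f : List A → T,
      (∀ t, f (W.take t) ∈ S) → ∃ x y z : List A, W = x ++ y ++ z ∧ s ≤ x.length ∧ y ≠ [] ∧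
        (x ++ y).length ≤ s + N ∧ f x = f (x ++ y) ∧
        ∀ n, x ++ (List.replicate n y).flatten ++ z ∈ L := by
  obtain ⟨σ, _, M, rfl⟩ := hL
  refine ⟨((Set.univ : Set σ) ×ˢ S).ncard, fun W hW s hs f hf => ?_⟩
  obtain ⟨i, j, hsi, hij, hj, heq⟩ :=
    exists_lt_map_eq_of_forall_mem_finite (Set.finite_univ.prod hS)
      (f := fun t => (M.eval (W.take t), f (W.take t))) (fun t => ⟨Set.mem_univ _, hf t⟩) s
  obtain ⟨heval, hlabel⟩ := Prod.mk.inj heq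
  have hxy : W.take i ++ (W.take j).drop i = W.take j := by
    simpa [List.take_take, hij.le] using List.take_append_drop i (W.take j)
  have hxyz : W.take i ++ (W.take j).drop i ++ W.drop j = W := by
    rw [hxy, List.take_append_drop]
  refine ⟨W.take i, (W.take j).drop i, W.drop j, hxyz.symm, ?_, ?_, ?_, by rwa [hxy],
    append_flatten_replicate_append_mem_accepts (hxyz.symm ▸ hW) (by rwa [hxy])⟩
  · rw [List.length_take]; omega
  · rw [← List.length_pos_iff, List.length_drop, List.length_take]; omega
  · rw [hxy, List.length_take]; omega

end Pumping

section LanguageLength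

variable {A G : Type*} [Group G] {μ : A → G} {L : Language A}

namespace IsBiautomaticStructure

theorem exists_length_le_add (hL : IsBiautomaticStructure μ L) (p q : G) :
    ∃ C : ℕ, ∀ U ∈ L, ∃ V ∈ L, wordEval μ V = p⁻¹ * wordEval μ U * q ∧
      V.length ≤ U.length + C := by
  obtain ⟨S, hS, hmem⟩ := hL.uniformlyFellowTravels p q
  obtain ⟨N, hN⟩ := exists_pumping_of_isRegular hL.regular hS
  refine ⟨N, fun U hU => ?_⟩
  obtain ⟨V, ⟨hV, hUV⟩, hmin⟩ := exists_minimalFor_of_wellFoundedLT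
    (fun V => V ∈ L ∧ wordEval μ V = p⁻¹ * wordEval μ U * q) List.length (hL.represents _)
  refine ⟨V, hV, hUV, ?_⟩
  by_contra! hlt
  -- Beyond time `U.length` the path of `U` is constant, so a repeated difference closes a loop of
  -- the path of `V`, which can be removed.
  obtain ⟨x, y, z, rfl, hx, hy, -, hlabel, hpump⟩ := hN V hV U.length hlt.le
    (fun P => (wordEval μ (U.take P.length))⁻¹ * p * wordEval μ P) fun t => by
      simpa [← List.take_eq_take_min] using hmem U hU V hV hUV (min t V.length)
  have hloop : wordEval μ y = 1 := by
    have hxy : U.length ≤ (x ++ y).length := by rw [List.length_append]; omega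
    rw [List.take_of_length_le hx, List.take_of_length_le hxy, wordEval_append] at hlabel
    simpa [mul_assoc] using hlabel
  have hshort : wordEval μ (x ++ z) = p⁻¹ * wordEval μ U * q := by
    rw [← hUV, wordEval_append, wordEval_append, wordEval_append, hloop, mul_one]
  have hlen := hmin ⟨by simpa using hpump 0, hshort⟩ (by simp)
  have := List.length_pos_iff.2 hy
  simp only [List.length_append] at hlen
  omega

end IsBiautomaticStructure

end LanguageLength

section PumpingInCentralizers

open scoped Pointwise

variable {A G : Type*} [Group G] {μ : A → G} {L : Language A} {X : Set G}

/-- The pairs `(c, ℓ)` such that the powers of `c` are, up to a fixed right factor in `H`,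
represented by words of `L` whose length grows at rate at most `ℓ`. They arise by pumping a factor
of length `ℓ` of a word of `L`. -/
def pumpBounds (μ : A → G) (L : Language A) (H : Subgroup G) : Set (H × ℕ) :=
  {c | 0 < c.2 ∧ ∃ (k : H) (m : ℕ), ∀ n : ℕ, ∃ W ∈ L,
    wordEval μ W = (c.1 ^ n * k : H) ∧ W.length ≤ m + n * c.2}

theorem mem_pumpBounds_of_pumping {H : Subgroup G} {x y z : List A} (hy : y ≠ [])
    (hpump : ∀ n, x ++ (List.replicate n y).flatten ++ z ∈ L) {c k : H}
    (hc : (c : G) = wordEval μ x * wordEval μ y * (wordEval μ x)⁻¹)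
    (hk : (k : G) = wordEval μ (x ++ z)) : (c, y.length) ∈ pumpBounds μ L H := by
  refine ⟨List.length_pos_iff.2 hy, k, x.length + z.length, fun n => ⟨_, hpump n, ?_, ?_⟩⟩
  · rw [wordEval_append_flatten_replicate_append, Subgroup.coe_mul, Subgroup.coe_pow, hc, hk]
  · simp only [List.length_append, List.length_flatten, List.map_replicate, List.sum_replicate,
      smul_eq_mul]
    omega

theorem mul_inv_mem_centralizer_of_conj_eq {u v : G}
    (huv : ∀ a ∈ X, u⁻¹ * a * u = v⁻¹ * a * v) : v * u⁻¹ ∈ Subgroup.centralizer X := by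
  intro a ha
  have hcomm := congrArg (fun g => v * g * u⁻¹) (huv a ha)
  simpa [mul_assoc] using hcomm.symm

namespace IsBiautomaticStructure

theorem exists_finite_pumpBounds_factor (hL : IsBiautomaticStructure μ L) (hX : X.Finite) :
    ∃ (N : ℕ) (C : Set (Subgroup.centralizer X × ℕ)), C.Finite ∧
      C ⊆ pumpBounds μ L (Subgroup.centralizer X) ∧
      ∀ W ∈ L, ∀ h : Subgroup.centralizer X, wordEval μ W = h → N ≤ W.length →
        ∃ c ∈ C, ∃ V ∈ L, wordEval μ V = (c.1⁻¹ * h : Subgroup.centralizer X) ∧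
          V.length + c.2 = W.length := by
  have := hL.finite_alphabet
  have := hX.to_subtype
  choose S hS hmem using fun a : X => hL.uniformlyFellowTravels (a : G) (a : G)
  obtain ⟨N, hN⟩ := exists_pumping_of_isRegular hL.regular (Set.Finite.pi' hS)
  refine ⟨N, pumpBounds μ L (Subgroup.centralizer X) ∩
      {c | (c.1 : G) ∈ wordBall μ N / wordBall μ N} ×ˢ Set.Iic N, ?_, Set.inter_subset_left, ?_⟩
  · exact ((((finite_wordBall μ N).div (finite_wordBall μ N)).preimage
      Subtype.val_injective.injOn).prod (Set.finite_Iic N)).subset Set.inter_subset_right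
  intro W hW h hWh hlen
  -- The conjugates of the elements of `X` by the prefixes of `W` are differences between the path
  -- of `W` and its translates by these elements, which have the same endpoint up to `X`.
  obtain ⟨x, y, z, rfl, -, hy, hxy, hlabel, hpump⟩ := hN W hW 0 (by omega)
    (fun P a => (wordEval μ P)⁻¹ * a * wordEval μ P) fun t a =>
      hmem a W hW W hW (by rw [hWh, mul_assoc, ← h.2 a a.2, inv_mul_cancel_left]) t
  have hc : wordEval μ x * wordEval μ y * (wordEval μ x)⁻¹ ∈ Subgroup.centralizer X := by
    rw [← wordEval_append]
    exact mul_inv_mem_centralizer_of_conj_eq fun a ha => congrFun hlabel ⟨a, ha⟩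
  have hxz : wordEval μ (x ++ z) = ((⟨_, hc⟩ : Subgroup.centralizer X)⁻¹ * h : G) := by
    rw [← hWh]
    simp [wordEval_append, mul_assoc]
  have hxN : x.length ≤ N := by rw [List.length_append] at hxy; omega
  have hyN : y.length ≤ N := by rw [List.length_append] at hxy; omega
  refine ⟨(⟨_, hc⟩, y.length), ⟨mem_pumpBounds_of_pumping hy hpump rfl
    (k := ⟨_, hc⟩⁻¹ * h) hxz.symm, ⟨?_, ?_⟩⟩, x ++ z, by simpa using hpump 0, hxz, ?_⟩
  · exact ⟨_, ⟨x ++ y, by simpa using hxy, rfl⟩, _, ⟨x, hxN, rfl⟩, by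
      simp [wordEval_append, div_eq_mul_inv]⟩
  · exact hyN
  · simp only [List.length_append]; omega

theorem exists_finite_pumpBounds_induction (hL : IsBiautomaticStructure μ L) (hX : X.Finite) :
    ∃ (B : Set (Subgroup.centralizer X)) (C : Set (Subgroup.centralizer X × ℕ)),
      B.Finite ∧ C.Finite ∧ C ⊆ pumpBounds μ L (Subgroup.centralizer X) ∧
      ∀ motive : Subgroup.centralizer X → ℕ → Prop,
        (∀ b ∈ B, ∀ n, motive b n) →
        (∀ h n, ∀ c ∈ C, motive h n → motive (c.1 * h) (n + c.2)) →
        ∀ W ∈ L, ∀ h : Subgroup.centralizer X, wordEval μ W = h → motive h W.length := by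
  have := hL.finite_alphabet
  obtain ⟨N, C, hC, hpump, hfactor⟩ := hL.exists_finite_pumpBounds_factor hX
  refine ⟨{h | (h : G) ∈ wordBall μ N}, C, ?_, hC, hpump, ?_⟩
  · exact (finite_wordBall μ N).preimage Subtype.val_injective.injOn
  intro motive hbase hstep W
  induction hn : W.length using Nat.strong_induction_on generalizing W with
  | _ n ih =>
    intro hW h hWh
    obtain hlt | hge := lt_or_ge W.length N
    · exact hbase h ⟨W, hlt.le, hWh⟩ n
    · obtain ⟨c, hc, V, hV, hVh, hlen⟩ := hfactor W hW h hWh hge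
      have hpos := (hpump hc).1
      have hmotive := hstep _ _ c hc (ih V.length (by omega) V rfl hV _ hVh)
      rwa [mul_inv_cancel_left, hlen, hn] at hmotive

theorem fg_centralizer (hL : IsBiautomaticStructure μ L) (hX : X.Finite) :
    Group.FG (Subgroup.centralizer X) := by
  obtain ⟨B, C, hB, hC, -, hinduct⟩ := hL.exists_finite_pumpBounds_induction hX
  refine Group.fg_iff.2 ⟨B ∪ Prod.fst '' C, (Subgroup.eq_top_iff' _).2 fun h => ?_,
    hB.union (hC.image _)⟩
  obtain ⟨W, hW, hWh⟩ := hL.represents h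
  refine hinduct (fun h _ => h ∈ Subgroup.closure (B ∪ Prod.fst '' C)) ?_ ?_ W hW h hWh
  · exact fun b hb _ => Subgroup.subset_closure (Or.inl hb)
  · exact fun h _ c hc hh =>
      mul_mem (Subgroup.subset_closure (Or.inr (Set.mem_image_of_mem _ hc))) hh

theorem exists_finite_pumpBounds_forall_le (hL : IsBiautomaticStructure μ L) (hX : X.Finite) :
    ∃ C ⊆ pumpBounds μ L (Subgroup.centralizer X), C.Finite ∧
      ∀ (f : Additive (Subgroup.centralizer X) →+ ℝ) (r : ℝ), 0 ≤ r →
        (∀ c ∈ C, f (.ofMul c.1) ≤ r * c.2) →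
        ∃ M : ℝ, ∀ W ∈ L, ∀ h : Subgroup.centralizer X, wordEval μ W = h →
          f (.ofMul h) ≤ r * W.length + M := by
  obtain ⟨B, C, hB, hC, hpump, hinduct⟩ := hL.exists_finite_pumpBounds_induction hX
  refine ⟨C, hpump, hC, fun f r hr hfC => ?_⟩
  obtain ⟨M, hM⟩ := (hB.image (f ∘ .ofMul)).bddAbove
  refine ⟨M, hinduct (fun h n => f (.ofMul h) ≤ r * n + M) (fun b hb n => ?_)
    fun h n c hc hle => ?_⟩
  · have hbM : f (.ofMul b) ≤ M := hM (Set.mem_image_of_mem _ hb)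
    have : 0 ≤ r * n := by positivity
    linarith
  · have hcr := hfC c hc
    rw [ofMul_mul, map_add, Nat.cast_add]
    linarith

end IsBiautomaticStructure

end PumpingInCentralizers

section CommensuratorAction

open Subgroup.Commensurable (commensurator)
open scoped IsMulCommutative Pointwise

variable {G : Type*} [Group G] {H : Subgroup G}

/-- The index of `H ∩ gHg⁻¹` in `H`. If `H` is abelian, conjugation by `g⁻¹` maps the powers of
elements of `H` with this exponent into `H`. -/
noncomputable def conjExponent (g : commensurator H) : ℕ :=
  (ConjAct.toConjAct (g : G) • H).relIndex H

theorem conjExponent_ne_zero (g : commensurator H) : conjExponent g ≠ 0 :=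
  g.2.1

theorem mem_conjAct_smul_iff {g x : G} : x ∈ ConjAct.toConjAct g • H ↔ g⁻¹ * x * g ∈ H := by
  rw [Subgroup.mem_pointwise_smul_iff_inv_smul_mem, ← ConjAct.toConjAct_inv,
    ConjAct.toConjAct_smul, inv_inv]

theorem inv_mul_mul_pow (g x : G) (n : ℕ) : (g⁻¹ * x * g) ^ n = g⁻¹ * x ^ n * g := by
  simpa using conj_pow (a := g⁻¹) (b := x) (i := n)

variable [IsMulCommutative H]

theorem conj_pow_conjExponent_mem (g : commensurator H) (h : H) :
    (g : G)⁻¹ * (h : G) ^ conjExponent g * g ∈ H :=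
  mem_conjAct_smul_iff.1
    (((ConjAct.toConjAct (g : G) • H).subgroupOf H).pow_index_mem h)

/-- The endomorphism `h ↦ g⁻¹ hᵐ g` of an abelian subgroup, where `m` is `conjExponent g`. -/
noncomputable def conjPowHom (g : commensurator H) : H →* H :=
  ((MulAut.conj (g : G)⁻¹).toMonoidHom.comp
    (H.subtype.comp (powMonoidHom (conjExponent g)))).codRestrict H fun h => by
      simpa using conj_pow_conjExponent_mem g h

theorem coe_conjPowHom (g : commensurator H) (h : H) :
    (conjPowHom g h : G) = (g : G)⁻¹ * (h : G) ^ conjExponent g * g := by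
  simp [conjPowHom]

/-- The action of an element of the commensurator of an abelian subgroup `H` on the real characters
of `H`. Conjugation does not preserve `H`, but the value at `h` can be read off the power
`conjPowHom g h`. -/
noncomputable def conjCharacter (g : commensurator H) :
    (Additive H →+ ℝ) →ₗ[ℝ] (Additive H →+ ℝ) where
  toFun f := (conjExponent g : ℝ)⁻¹ • f.comp (conjPowHom g).toAdditive
  map_add' f f' := by ext; simp [mul_add]
  map_smul' r f := by ext; simp [mul_left_comm]

theorem conjCharacter_apply (g : commensurator H) (f : Additive H →+ ℝ) (h : H) :
    conjCharacter g f (.ofMul h) = (conjExponent g : ℝ)⁻¹ * f (.ofMul (conjPowHom g h)) :=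
  rfl

theorem natCast_mul_conjCharacter (g : commensurator H) (f : Additive H →+ ℝ) {h k : H} {n : ℕ}
    (hk : (k : G) = (g : G)⁻¹ * (h : G) ^ n * g) :
    n * conjCharacter g f (.ofMul h) = f (.ofMul k) := by
  have hpow : conjPowHom g h ^ n = k ^ conjExponent g := by
    ext
    rw [Subgroup.coe_pow, Subgroup.coe_pow, coe_conjPowHom, hk, inv_mul_mul_pow, inv_mul_mul_pow,
      ← pow_mul, ← pow_mul, mul_comm]
  have hf := congrArg (fun x => f (.ofMul x)) hpow
  simp only [ofMul_pow, map_nsmul, nsmul_eq_mul] at hf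
  have hm : (conjExponent g : ℝ) ≠ 0 := by exact_mod_cast conjExponent_ne_zero g
  rw [conjCharacter_apply, mul_left_comm, hf, inv_mul_cancel_left₀ hm]

theorem conjCharacter_one : conjCharacter (1 : commensurator H) = 1 := by
  ext f h
  simpa using natCast_mul_conjCharacter 1 f (h := h) (k := h) (n := 1) (by simp)

theorem conjCharacter_mul (g g' : commensurator H) :
    conjCharacter (g * g') = conjCharacter g * conjCharacter g' := by
  ext f h
  have hgg' := natCast_mul_conjCharacter (g * g') f (h := h)
    (n := conjExponent g * conjExponent g') (k := conjPowHom g' (conjPowHom g h)) (by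
      rw [coe_conjPowHom, coe_conjPowHom, inv_mul_mul_pow, ← pow_mul]
      simp [mul_assoc])
  rw [← natCast_mul_conjCharacter g' f (coe_conjPowHom g' _),
    ← natCast_mul_conjCharacter g _ (coe_conjPowHom g _)] at hgg'
  have hm : (conjExponent g : ℝ) ≠ 0 := by exact_mod_cast conjExponent_ne_zero g
  have hm' : (conjExponent g' : ℝ) ≠ 0 := by exact_mod_cast conjExponent_ne_zero g'
  apply mul_left_cancel₀ (mul_ne_zero hm hm')
  rw [Nat.cast_mul] at hgg'
  simpa [mul_comm, mul_left_comm, mul_assoc] using hgg'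

/-- The representation of the commensurator of an abelian subgroup on its real characters. -/
noncomputable def commensuratorRepresentation (H : Subgroup G) [IsMulCommutative H] :
    Representation ℝ (commensurator H) (Additive H →+ ℝ) where
  toFun := conjCharacter
  map_one' := conjCharacter_one
  map_mul' := conjCharacter_mul

end CommensuratorAction

section FCCentralizer

open Subgroup.Commensurable (commensurator)
open scoped Pointwise

variable {G : Type*} [Group G]

/-- The FC-centralizer of a subgroup `H`: the elements of the group that centralize a subgroup of
finite index of `H`. -/
def fcCentralizer (H : Subgroup G) : Subgroup G where
  carrier := {g | (Subgroup.centralizer {g}).relIndex H ≠ 0}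
  one_mem' := by
    have htop : Subgroup.centralizer {(1 : G)} = ⊤ := by
      ext
      simp [Subgroup.mem_centralizer_singleton_iff]
    simp [htop]
  mul_mem' {a b} ha hb := by
    refine mt (Subgroup.relIndex_eq_zero_of_le_left fun x hx => ?_)
      (Subgroup.relIndex_inf_ne_zero ha hb)
    exact Subgroup.mem_centralizer_singleton_iff.2 (Commute.mul_right
      (Subgroup.mem_centralizer_singleton_iff.1 hx.1)
      (Subgroup.mem_centralizer_singleton_iff.1 hx.2))
  inv_mem' {a} ha := by
    refine mt (Subgroup.relIndex_eq_zero_of_le_left fun x hx => ?_) ha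
    exact Subgroup.mem_centralizer_singleton_iff.2
      (Commute.inv_right (Subgroup.mem_centralizer_singleton_iff.1 hx))

variable {H : Subgroup G}

theorem mem_fcCentralizer {g : G} :
    g ∈ fcCentralizer H ↔ (Subgroup.centralizer {g}).relIndex H ≠ 0 :=
  Iff.rfl

theorem centralizer_singleton_conj (g n : G) :
    Subgroup.centralizer {g * n * g⁻¹} = ConjAct.toConjAct g • Subgroup.centralizer {n} := by
  ext x
  rw [mem_conjAct_smul_iff, Subgroup.mem_centralizer_singleton_iff,
    Subgroup.mem_centralizer_singleton_iff]
  change Commute x (g * n * g⁻¹) ↔ Commute (g⁻¹ * x * g) n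
  rw [← Commute.conj_iff (a := g⁻¹ * x * g) g]
  simp [mul_assoc]

theorem conj_mem_fcCentralizer {g n : G} (hg : g ∈ commensurator H) (hn : n ∈ fcCentralizer H) :
    g * n * g⁻¹ ∈ fcCentralizer H := by
  have hconj : (ConjAct.toConjAct g • Subgroup.centralizer {n}).relIndex
      (ConjAct.toConjAct g • H) ≠ 0 := by
    rwa [Subgroup.relIndex_pointwise_smul]
  rw [mem_fcCentralizer, centralizer_singleton_conj]
  exact Subgroup.relIndex_ne_zero_trans hconj hg.1

instance normal_fcCentralizer_subgroupOf_commensurator :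
    ((fcCentralizer H).subgroupOf (commensurator H)).Normal where
  conj_mem n hn g := by
    rw [Subgroup.mem_subgroupOf] at hn ⊢
    exact conj_mem_fcCentralizer g.2 hn

theorem exists_le_centralizer_of_fg {F : Subgroup G} (hF : F.FG) (hle : F ≤ fcCentralizer H) :
    ∃ K : Subgroup G, K ≤ H ∧ (K.subgroupOf H).FiniteIndex ∧
      F ≤ Subgroup.centralizer (K : Set G) := by
  obtain ⟨S, rfl⟩ := hF
  refine ⟨(⨅ s : S, Subgroup.centralizer {(s : G)}) ⊓ H, inf_le_right, ⟨?_⟩, ?_⟩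
  · change Subgroup.relIndex _ _ ≠ 0
    rw [Subgroup.inf_relIndex_right]
    exact Subgroup.relIndex_iInf_ne_zero fun s => hle (Subgroup.subset_closure s.2)
  · rw [Subgroup.closure_le]
    intro s hs k hk
    exact Subgroup.mem_centralizer_singleton_iff.1 (Subgroup.mem_iInf.1 hk.1 ⟨s, hs⟩)

end FCCentralizer

section KernelOfCommensuratorRepresentation

open Subgroup.Commensurable (commensurator)
open scoped IsMulCommutative

theorem isOfFinOrder_of_forall_addMonoidHom_real_eq_zero {H : Type*} [CommGroup H] [Group.FG H]
    {h : H} (hh : ∀ f : Additive H →+ ℝ, f (.ofMul h) = 0) : IsOfFinOrder h := by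
  have : Module.Finite ℤ (Additive H) := Module.Finite.iff_addGroup_fg.2 inferInstance
  have hquot : (Submodule.torsion ℤ (Additive H)).mkQ (.ofMul h) = 0 := by
    rw [← Module.forall_dual_apply_eq_zero_iff ℤ]
    intro φ
    have hφ := hh ((Int.castAddHom ℝ).comp
      (φ.comp (Submodule.torsion ℤ (Additive H)).mkQ).toAddMonoidHom)
    exact Int.cast_injective (hφ.trans Int.cast_zero.symm)
  rw [Submodule.mkQ_apply, Submodule.Quotient.mk_eq_zero, Submodule.mem_torsion_iff] at hquot
  obtain ⟨n, hn⟩ := hquot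
  exact isOfFinOrder_iff_zpow_eq_one.2 ⟨n, nonZeroDivisors.coe_ne_zero n, hn⟩

theorem finiteIndex_of_forall_exists_pow_mem {H : Type*} [CommGroup H] [Group.FG H]
    {K : Subgroup H} (hK : ∀ h, ∃ n : ℕ, 0 < n ∧ h ^ n ∈ K) : K.FiniteIndex := by
  have htorsion : IsMulTorsion (H ⧸ K) := by
    intro x
    obtain ⟨h, rfl⟩ := QuotientGroup.mk_surjective x
    obtain ⟨n, hn, hmem⟩ := hK h
    exact isOfFinOrder_iff_pow_eq_one.2 ⟨n, hn, (QuotientGroup.eq_one_iff _).2 hmem⟩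
  have := CommGroup.finite_of_fg_isMulTorsion _ htorsion
  exact Subgroup.finiteIndex_of_finite_quotient

variable {G : Type*} [Group G] {H : Subgroup G} [IsMulCommutative H]

theorem ker_commensuratorRepresentation_le_fcCentralizer [Group.FG H] :
    (commensuratorRepresentation H).ker ≤ (fcCentralizer H).subgroupOf (commensurator H) := by
  intro g hg
  refine (finiteIndex_of_forall_exists_pow_mem
    (K := (Subgroup.centralizer {(g : G)}).subgroupOf H) fun h => ?_).index_ne_zero
  obtain ⟨n, hn, hpow⟩ := isOfFinOrder_iff_pow_eq_one.1
    (isOfFinOrder_of_forall_addMonoidHom_real_eq_zero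
      (h := conjPowHom g h * (h ^ conjExponent g)⁻¹) fun f => by
        have hgf : conjCharacter g f = f := congrArg (· f) (MonoidHom.mem_ker.1 hg)
        rw [ofMul_mul, map_add, ← natCast_mul_conjCharacter g f (coe_conjPowHom g h), hgf]
        simp)
  refine ⟨conjExponent g * n, Nat.mul_pos (conjExponent_ne_zero g).bot_lt hn, ?_⟩
  have hfix : (g : G)⁻¹ * (h : G) ^ (conjExponent g * n) * g = h ^ (conjExponent g * n) := by
    rw [mul_pow, inv_pow, mul_inv_eq_one, ← pow_mul] at hpow
    rw [pow_mul, ← inv_mul_mul_pow, ← coe_conjPowHom]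
    rw [← Subgroup.coe_pow, hpow, pow_mul, Subgroup.coe_pow, Subgroup.coe_pow]
  rw [Subgroup.mem_subgroupOf, Subgroup.mem_centralizer_singleton_iff, Subgroup.coe_pow]
  rwa [mul_assoc, inv_mul_eq_iff_eq_mul] at hfix

end KernelOfCommensuratorRepresentation

section LengthBoundedCharacters

open Subgroup.Commensurable (commensurator)
open scoped Pointwise

variable {A G : Type*} [Group G] {μ : A → G} {L : Language A} {H : Subgroup G}

/-- The real characters of `H` that are at most the length of any word of `L` representing the
argument, up to an additive constant. -/
def lengthBoundedCharacters (μ : A → G) (L : Language A) (H : Subgroup G) :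
    Set (Additive H →+ ℝ) :=
  {f | ∃ M : ℝ, ∀ W ∈ L, ∀ h : H, wordEval μ W = h → f (.ofMul h) ≤ W.length + M}

/-- Evaluation at `x` as a linear form on the space of real characters of `B`. -/
def characterEval {B : Type*} [AddMonoid B] (x : B) : (B →+ ℝ) →ₗ[ℝ] ℝ where
  toFun f := f x
  map_add' _ _ := rfl
  map_smul' _ _ := rfl

theorem le_of_forall_natCast_mul_le_add {𝕜 : Type*} [Field 𝕜] [LinearOrder 𝕜]
    [IsStrictOrderedRing 𝕜] [Archimedean 𝕜] {a b M : 𝕜} (h : ∀ n : ℕ, n * a ≤ n * b + M) :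
    a ≤ b := by
  by_contra! hlt
  obtain ⟨n, hn⟩ := exists_nat_gt (M / (a - b))
  rw [div_lt_iff₀ (sub_pos.2 hlt), mul_sub] at hn
  linarith [h n]

theorem addMonoidHom_eq_zero_of_forall_le {𝕜 B : Type*} [Field 𝕜] [LinearOrder 𝕜]
    [IsStrictOrderedRing 𝕜] [Archimedean 𝕜] [AddGroup B] {f : B →+ 𝕜} {M : 𝕜}
    (hf : ∀ x, f x ≤ M) : f = 0 := by
  have hnonpos : ∀ x, f x ≤ 0 := fun x =>
    le_of_forall_natCast_mul_le_add (M := M) fun n => by simpa using hf (n • x)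
  ext x
  have hneg := hnonpos (-x)
  rw [map_neg] at hneg
  exact le_antisymm (hnonpos x) (by simpa using hneg)

theorem apply_le_of_mem_pumpBounds {f : Additive H →+ ℝ} (hf : f ∈ lengthBoundedCharacters μ L H)
    {c : H × ℕ} (hc : c ∈ pumpBounds μ L H) : f (.ofMul c.1) ≤ c.2 := by
  obtain ⟨M, hM⟩ := hf
  obtain ⟨-, k, m, hpump⟩ := hc
  refine le_of_forall_natCast_mul_le_add (M := m + M - f (.ofMul k)) fun n => ?_
  obtain ⟨W, hW, hWc, hlen⟩ := hpump n
  have hle := hM W hW _ hWc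
  have hlen' : (W.length : ℝ) ≤ m + n * c.2 := by exact_mod_cast hlen
  rw [ofMul_mul, map_add, ofMul_pow, map_nsmul, nsmul_eq_mul] at hle
  linarith

namespace IsBiautomaticStructure

theorem mapsTo_lengthBoundedCharacters [IsMulCommutative H] (hL : IsBiautomaticStructure μ L)
    (g : commensurator H) : Set.MapsTo (commensuratorRepresentation H g)
      (lengthBoundedCharacters μ L H) (lengthBoundedCharacters μ L H) := by
  rintro f ⟨M, hM⟩
  let K := (ConjAct.toConjAct (g : G) • H).subgroupOf H
  have : K.FiniteIndex := ⟨g.2.1⟩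
  choose C hC using fun t : H ⧸ K => hL.exists_length_le_add (t.out * g) g
  obtain ⟨M', hM'⟩ := (Set.finite_range fun t : H ⧸ K =>
    conjCharacter g f (.ofMul t.out) + (C t + M)).bddAbove
  refine ⟨M', fun W hW h hWh => ?_⟩
  -- Write `h = t k` with `t` in a finite transversal and `k ∈ H ∩ gHg⁻¹`. A word for `g⁻¹ k g` is
  -- then at most boundedly longer than `W`.
  let t : H ⧸ K := QuotientGroup.mk h
  have hk : (g : G)⁻¹ * (t.out⁻¹ * h : H) * g ∈ H :=
    mem_conjAct_smul_iff.1 (Subgroup.mem_subgroupOf.1 (QuotientGroup.eq.1 t.out_eq'))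
  obtain ⟨V, hV, hVk, hlen⟩ := hC t W hW
  have hfk : conjCharacter g f (.ofMul (t.out⁻¹ * h)) = f (.ofMul ⟨_, hk⟩) := by
    simpa using natCast_mul_conjCharacter g f (n := 1) (h := t.out⁻¹ * h) (k := ⟨_, hk⟩) (by simp)
  have hle := hM V hV ⟨_, hk⟩ (by rw [hVk, hWh]; simp [mul_assoc])
  have hlen' : (V.length : ℝ) ≤ W.length + C t := by exact_mod_cast hlen
  have hM't := hM' (Set.mem_range_self t)
  calc conjCharacter g f (.ofMul h)
      = conjCharacter g f (.ofMul t.out) + conjCharacter g f (.ofMul (t.out⁻¹ * h)) := by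
        rw [← map_add, ← ofMul_mul, mul_inv_cancel_left]
    _ ≤ conjCharacter g f (.ofMul t.out) + (W.length + C t + M) := by
        rw [hfk]
        gcongr
        linarith
    _ ≤ W.length + M' := by linarith

theorem finiteIndex_ker_commensuratorRepresentation (hL : IsBiautomaticStructure μ L) {X : Set G}
    (hX : X.Finite) [IsMulCommutative (Subgroup.centralizer X)] :
    (commensuratorRepresentation (Subgroup.centralizer X)).ker.FiniteIndex := by
  obtain ⟨C, hpump, hC, hdom⟩ := hL.exists_finite_pumpBounds_forall_le hX
  have := hC.to_subtype
  have hpoly : lengthBoundedCharacters μ L (Subgroup.centralizer X) =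
      polyhedron (fun c : C => characterEval (Additive.ofMul c.1.1))
        (fun c : C => (c.1.2 : ℝ)) := by
    ext f
    refine ⟨fun hf c => apply_le_of_mem_pumpBounds hf (hpump c.2), fun hf => ?_⟩
    simpa [lengthBoundedCharacters] using
      hdom f 1 zero_le_one fun c hc => by simpa [characterEval] using hf ⟨c, hc⟩
  refine finiteIndex_ker_of_mapsTo_polyhedron
    (φ := fun c : C => characterEval (Additive.ofMul c.1.1)) (b := fun c : C => (c.1.2 : ℝ))
    (fun f hf => ?_) (fun c => by exact_mod_cast (hpump c.2).1) _
    fun g => hpoly ▸ hL.mapsTo_lengthBoundedCharacters g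
  obtain ⟨M, hM⟩ := hdom f 0 le_rfl fun c hc => by simpa [characterEval] using hf ⟨c, hc⟩
  refine addMonoidHom_eq_zero_of_forall_le (M := M) fun h => ?_
  obtain ⟨W, hW, hWh⟩ := hL.represents (h.toMul : Subgroup.centralizer X)
  simpa using hM W hW _ hWh

end IsBiautomaticStructure

end LengthBoundedCharacters

theorem IsBiautomatic.finiteIndex_fcCentralizer_subgroupOf_commensurator {G : Type*} [Group G]
    (hG : IsBiautomatic G) {X : Set G} (hX : X.Finite)
    [IsMulCommutative (Subgroup.centralizer X)] :
    ((fcCentralizer (Subgroup.centralizer X)).subgroupOf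
      (Subgroup.Commensurable.commensurator (Subgroup.centralizer X))).FiniteIndex := by
  obtain ⟨A, μ, L, hL⟩ := hG
  have := hL.fg_centralizer hX
  have := hL.finiteIndex_ker_commensuratorRepresentation hX
  exact Subgroup.finiteIndex_of_le ker_commensuratorRepresentation_le_fcCentralizer

theorem mainTheorem5 {G : Type*} [Group G] (hG : IsBiautomatic G) (X : Set G) (hX : X.Finite)
    (H : Subgroup G) (hH : H = Subgroup.centralizer X) (hab : IsMulCommutative H) :
    ∃ N : Subgroup (Subgroup.Commensurable.commensurator H), N.Normal ∧ N.FiniteIndex ∧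
      ∀ F : Subgroup G, F.FG → F ≤ N.map (Subgroup.Commensurable.commensurator H).subtype →
        ∃ K : Subgroup G, K ≤ H ∧ (K.subgroupOf H).FiniteIndex ∧
          F ≤ Subgroup.centralizer (K : Set G) := by
  subst hH
  refine ⟨(fcCentralizer (Subgroup.centralizer X)).subgroupOf _, inferInstance,
    hG.finiteIndex_fcCentralizer_subgroupOf_commensurator hX, fun F hF hle => ?_⟩
  exact exists_le_centralizer_of_fg hF
    (hle.trans ((Subgroup.subgroupOf_map_subtype _ _).trans_le inf_le_left))
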